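/- **Tree MDPs.** For an integer $H\ge 1$, $\gamma\in(0,1)$, a leaf $s^*$ and an action $a^*$, let $M_H=M_H(\gamma,s^*,a^*)$ be the following deterministic MDP with discount $\gamma$, two actions and $|\mathcal S|=2^H$ states: the $2^H-1$ nodes of the full binary tree with $H$ levels, and one absorbing terminal state. Episodes start at the root; at an inner node the first action leads to the left child and the second to the right child; at a leaf (a node of the last level) both actions lead to the terminal state. The reward is $1$ for taking $a^*$ at $s^*$ and $0$ otherwise. Let $(\mathcal B^*Q)(s,a)=r(s,a)+\gamma\,\mathbb E_{s'}[\max_{a'}Q(s',a')]$, let $Q^*$ be its fixed point, and let $d^\pi(s,a)=(1-\gamma)\sum_{t\ge0}\gamma^t\,\mathbb P^\pi(s_t=s)\,\pi(a\mid s)$. **Algorithm.** Given features $\Phi\in\mathbb R^{(\mathcal S\times\mathcal A)\times d}$ (rows $\phi(s,a)$), write $Q_w=\Phi w$. Given policies $\pi_0,\pi_1,\dots$, exact projected fitted Q-iteration produces weights $w_0,w_1,\dots$ with $w_0$ given and $$w_{k+1}\in\arg\min_{w}\ \mathbb E_{(s,a)\sim\mu_k}\big[(Q_w(s,a)-(\mathcal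 B^*Q_{w_k})(s,a))^2\big],$$ where either $\mu_k=d^{\pi_k}$ for all $k$ (on-policy) or $\mu_k=\frac1{k+1}\sum_{i=0}^k d^{\pi_i}$ for all $k$ (replay buffer). **Theorem.** There is a universal constant $C>0$ such that for all $\varepsilon,\gamma\in(0,1)$ there are, for every $H\ge1$, a dimension $d_H$ and features $\Phi_H\in\mathbb R^{(\mathcal S\times\mathcal A)\times d_H}$, with zero rows at the terminal state, such that: 1. for every $H\ge1$: $d_H\le C\,H^2/\varepsilon^2$; $|(I-\Phi_H\Phi_H^{T})_{xy}|\le\varepsilon$ for all pairs $x,y$ of non-terminal state-action pairs; and for all $s^*,a^*$ there is a $w$ with $\|Q^*-\Phi_Hw\|_\infty\le\varepsilon$; 2. for every $\bar p\in(0,\tfrac12)$ and every accuracy $\eta\in(0,1)$ (for instance $\eta=\varepsilon$) there is a $c>0$, depending only on $\varepsilon,\gamma,\bar p,\eta$ and the chosen family $(\Phi_H)_{H}$, such that for every $H\ge1$, all $s^*,a^*$, all sequences of policies with $\pi_k(a\mid s)\ge\bar p$ for all $k,s,a$ ($\pi_k$ may depend in any way on the iterates), both choices of $\mu_k$, and every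 run $w_0,w_1,\dots$ of the algorithm on $M_H(\gamma,s^*,a^*)$ with features $\Phi_H$ whose initialization is not already $\eta$-accurate, $\|Q_{w_0}-Q^*\|_\infty>\eta$ (for instance $w_0=0$): $$\|Q_{w_K}-Q^*\|_\infty\le\eta\ \Longrightarrow\ K\ \ge\ c\,\gamma^{-H}.$$ That is, $\Omega(\gamma^{-H})$ exact Bellman projection steps are needed to reach an $\eta$-accurate Q-function, if one is reached at all. -/

import Mathlib

noncomputable section

/-- A finite discounted Markov decision process `(S, A, T, r, γ)` with initial
state distribution `ρ`. -/
structure FiniteMDP (S A : Type) [Fintype S] [Fintype A] where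
  /-- `T s a s'` is the probability of moving from `s` to `s'` under action `a`. -/
  T : S → A → S → ℝ
  T_nonneg : ∀ s a s', 0 ≤ T s a s'
  T_sum : ∀ s a, ∑ s', T s a s' = 1
  /-- The reward function. -/
  r : S → A → ℝ
  /-- The initial state distribution. -/
  ρ : S → ℝ
  ρ_nonneg : ∀ s, 0 ≤ ρ s
  ρ_sum : ∑ s, ρ s = 1
  /-- The discount factor. -/
  γ : ℝ
  γ_pos : 0 < γ
  γ_lt_one : γ < 1

/-- A stationary stochastic policy; `prob s a` is `π(a | s)`. -/
structure Policy (S A : Type) [Fintype A] where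
  prob : S → A → ℝ
  prob_nonneg : ∀ s a, 0 ≤ prob s a
  prob_sum : ∀ s, ∑ a, prob s a = 1

namespace FiniteMDP

variable {S A : Type} [Fintype S] [Fintype A]

/-- The Bellman optimality operator
`(B* Q)(s, a) = r(s, a) + γ E_{s' ~ T(· | s, a)} [max_{a'} Q(s', a')]`. -/
def bellman (M : FiniteMDP S A) (Q : S × A → ℝ) : S × A → ℝ :=
  fun x => M.r x.1 x.2 + M.γ * ∑ s', M.T x.1 x.2 s' * ⨆ a', Q (s', a')

theorem abs_iSup_sub_iSup_le [Nonempty A] (Q Q' : S × A → ℝ) (s : S) :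
    |(⨆ a, Q (s, a)) - ⨆ a, Q' (s, a)| ≤ dist Q Q' := by
  have key : ∀ P P' : S × A → ℝ, (⨆ a, P (s, a)) ≤ (⨆ a, P' (s, a)) + dist P P' := by
    intro P P'
    refine ciSup_le fun a => ?_
    have h1 : P' (s, a) ≤ ⨆ a, P' (s, a) :=
      le_ciSup (f := fun a => P' (s, a)) (Set.finite_range _).bddAbove a
    have h2 : |P (s, a) - P' (s, a)| ≤ dist P P' := dist_le_pi_dist P P' (s, a)
    have h3 := (abs_le.mp h2).2
    linarith
  have h1 := key Q Q'
  have h2 := key Q' Q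
  rw [dist_comm] at h2
  exact abs_le.mpr ⟨by linarith, by linarith⟩

/-- The Bellman optimality operator is a `γ`-contraction in the sup norm. -/
theorem bellman_contracting [Nonempty A] (M : FiniteMDP S A) :
    ContractingWith ⟨M.γ, M.γ_pos.le⟩ M.bellman := by
  refine ⟨by exact_mod_cast M.γ_lt_one, LipschitzWith.of_dist_le_mul fun Q Q' => ?_⟩
  refine (dist_pi_le_iff (mul_nonneg M.γ_pos.le dist_nonneg)).mpr fun x => ?_
  have h : M.bellman Q x - M.bellman Q' x =
      M.γ * ∑ s', M.T x.1 x.2 s' * ((⨆ a', Q (s', a')) - ⨆ a', Q' (s', a')) := by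
    simp only [bellman, mul_sub, Finset.sum_sub_distrib]
    ring
  rw [Real.dist_eq, h, abs_mul, abs_of_pos M.γ_pos]
  refine mul_le_mul_of_nonneg_left ?_ M.γ_pos.le
  calc |∑ s', M.T x.1 x.2 s' * ((⨆ a', Q (s', a')) - ⨆ a', Q' (s', a'))|
      ≤ ∑ s', |M.T x.1 x.2 s' * ((⨆ a', Q (s', a')) - ⨆ a', Q' (s', a'))| :=
        Finset.abs_sum_le_sum_abs _ _
    _ ≤ ∑ s', M.T x.1 x.2 s' * dist Q Q' := by
        refine Finset.sum_le_sum fun s' _ => ?_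
        rw [abs_mul, abs_of_nonneg (M.T_nonneg _ _ _)]
        exact mul_le_mul_of_nonneg_left (abs_iSup_sub_iSup_le Q Q' s') (M.T_nonneg _ _ _)
    _ = dist Q Q' := by rw [← Finset.sum_mul, M.T_sum, one_mul]

/-- The optimal Q-function: the unique fixed point of the Bellman optimality operator. -/
def Qstar [Nonempty A] (M : FiniteMDP S A) : S × A → ℝ :=
  ContractingWith.fixedPoint M.bellman M.bellman_contracting

/-- The law of the state at time `t` when following `π`. -/
def stateLaw (M : FiniteMDP S A) (π : Policy S A) : ℕ → S → ℝ
  | 0 => M.ρ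
  | t + 1 => fun s' => ∑ s, ∑ a, M.stateLaw π t s * π.prob s a * M.T s a s'

/-- The discounted state-action marginal
`d^π(s, a) = (1 - γ) ∑_t γ^t P^π(s_t = s) π(a | s)`. -/
def occupancy (M : FiniteMDP S A) (π : Policy S A) : S × A → ℝ :=
  fun x => ((1 - M.γ) * ∑' t, M.γ ^ t * M.stateLaw π t x.1) * π.prob x.1 x.2

/-- On-policy data: at iteration `k` the data distribution is `d^{π_k}`. -/
def onPolicyData (M : FiniteMDP S A) (π : ℕ → Policy S A) (k : ℕ) : S × A → ℝ :=
  M.occupancy (π k)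

/-- Replay-buffer data: at iteration `k` the data distribution is the uniform mixture of
`d^{π_0}, …, d^{π_k}`. -/
def replayData (M : FiniteMDP S A) (π : ℕ → Policy S A) (k : ℕ) : S × A → ℝ :=
  fun x => (1 / ((k : ℝ) + 1)) * ∑ i ∈ Finset.range (k + 1), M.occupancy (π i) x

/-- The linear Q-function `Q_w(s, a) = ⟨φ(s, a), w⟩`, where `φ(s, a)` is the row `(s, a)`
of `Φ`. -/
def linearQ {d : ℕ} (Φ : Matrix (S × A) (Fin d) ℝ) (w : Fin d → ℝ) : S × A → ℝ :=
  Φ.mulVec w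

/-- The squared loss `E_{(s, a) ~ μ} [(Q(s, a) - Y(s, a))²]`. -/
def sqLoss (μ : S × A → ℝ) (Q Y : S × A → ℝ) : ℝ :=
  ∑ x, μ x * (Q x - Y x) ^ 2

/-- `Q_w` is a projection, in `μ`-weighted least squares, of the target `Y` onto the
linear function class given by `Φ`. -/
def IsProjection {d : ℕ} (Φ : Matrix (S × A) (Fin d) ℝ) (μ Y : S × A → ℝ)
    (w : Fin d → ℝ) : Prop :=
  ∀ w' : Fin d → ℝ, sqLoss μ (linearQ Φ w) Y ≤ sqLoss μ (linearQ Φ w') Y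

/-- `w 0, w 1, …` are the weights produced by exact projected fitted Q-iteration with data
distributions `μ 0, μ 1, …`, that is, `Q_{w (k+1)} = Π_{μ k} (B* Q_{w k})`. -/
def IsFittedQRun (M : FiniteMDP S A) {d : ℕ} (Φ : Matrix (S × A) (Fin d) ℝ)
    (μ : ℕ → S × A → ℝ) (w : ℕ → Fin d → ℝ) : Prop :=
  ∀ k, IsProjection Φ (μ k) (M.bellman (linearQ Φ (w k))) (w (k + 1))

end FiniteMDP

/-- The `2 ^ H` states of the tree MDP with `H` levels. State `0` is the absorbing terminal
state; the states `1, …, 2 ^ H - 1` are the nodes of the full binary tree with `H` levels in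
breadth-first numbering: `1` is the root and the children of `i` are `2 * i` and
`2 * i + 1`. -/
abbrev TreeState (H : ℕ) : Type := Fin (2 ^ H)

/-- The terminal state. -/
def treeTerminal (H : ℕ) : TreeState H := ⟨0, Nat.two_pow_pos H⟩

/-- The root of the tree (for `H ≥ 1` this is state `1`). -/
def treeRoot (H : ℕ) : TreeState H := ⟨1 % 2 ^ H, Nat.mod_lt _ (Nat.two_pow_pos H)⟩

/-- The leaves, that is, the nodes of the last level: those without children. -/
def IsTreeLeaf {H : ℕ} (s : TreeState H) : Prop := 2 ^ H ≤ 2 * s.val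

/-- Deterministic transitions: action `0` leads to the left child and action `1` to the right
child; at a leaf every action ends the episode; the terminal state is absorbing. -/
def treeNext {H : ℕ} (s : TreeState H) (a : Fin 2) : TreeState H :=
  if h : s.val ≠ 0 ∧ 2 * s.val + a.val < 2 ^ H then ⟨2 * s.val + a.val, h.2⟩
  else treeTerminal H

/-- The tree MDP with discount `γ`: episodes start at the root, and the only nonzero reward is
a reward of `1` for taking action `aStar` at `sStar`. -/
def treeMDP (H : ℕ) (γ : ℝ) (hγ0 : 0 < γ) (hγ1 : γ < 1) (sStar : TreeState H)
    (aStar : Fin 2) : FiniteMDP (TreeState H) (Fin 2) where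
  T s a s' := if s' = treeNext s a then 1 else 0
  T_nonneg s a s' := by split_ifs <;> norm_num
  T_sum s a := by simp
  r s a := if s = sStar ∧ a = aStar then 1 else 0
  ρ s := if s = treeRoot H then 1 else 0
  ρ_nonneg s := by split_ifs <;> norm_num
  ρ_sum := by simp
  γ := γ
  γ_pos := hγ0
  γ_lt_one := hγ1

/-- `Φ` is an `ε`-approximate factorization of the identity on the state-action pairs of the
tree, `‖I - Φ Φᵀ‖_∞ ≤ ε` with the entrywise maximum norm; the features of the terminal state,
whose value is known to be zero, vanish. -/
def IsEpsRankFeatures {H d : ℕ} (ε : ℝ) (Φ : Matrix (TreeState H × Fin 2) (Fin d) ℝ) : Prop :=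
  (∀ a j, Φ (treeTerminal H, a) j = 0) ∧
  ∀ x y : TreeState H × Fin 2, x.1 ≠ treeTerminal H → y.1 ≠ treeTerminal H →
    |((1 : Matrix (TreeState H × Fin 2) (TreeState H × Fin 2) ℝ) - Φ * Φ.transpose) x y| ≤ ε

end

/-!
Copies of a Hadamard matrix of size `2 ^ D = O(H / ε ^ 2)`, with columns modulated by random signs,
yield `2 ^ (H + 1)` nearly orthonormal vectors such that each aligned block of `2 ^ D` consecutive
ones is an orthonormal basis. In breadth-first numbering such a block consists of the pairs at the
leaves below a common node.

The features put each level of the tree into its own block of coordinates. On the leaf level the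
Bellman target is the indicator of the rewarded pair `m`, so the normal equation of the projection,
tested against the fitted values `f n = ψ n ⬝ᵥ u`, reads `∑ n, P n * f n ^ 2 = P m * f m`, where
`P n` is the probability of reaching the pair `n`. An exploring policy gives each pair of a block at
least the share `p ^ D` of the mass of the block, so Parseval's identity in the blocks and
Cauchy-Schwarz bound the left side below by `p ^ D * f m ^ 2`. Hence
`p ^ D * f m ≤ P m ≤ (1 - p) ^ H`. As `p ^ D` is only polynomially small in `H`, for tall trees no
iterate after the initialization has a value near `1` at the rewarded pair, where `Q*` is `1`.
-/

open Finset Matrix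

theorem exists_isHadamard_two_pow (D : ℕ) :
    ∃ A : Matrix (Fin (2 ^ D)) (Fin (2 ^ D)) ℝ, A.IsHadamard := by
  induction D with
  | zero =>
    change ∃ A : Matrix (Fin 1) (Fin 1) ℝ, A.IsHadamard
    refine ⟨1, fun i j => ?_, by simp, by simp⟩
    rw [Subsingleton.elim i j, one_apply_eq]
    exact one_mem _
  | succ D ih =>
    obtain ⟨A, hA⟩ := ih
    have hB : (!![1, 1; 1, -1] : Matrix (Fin 2) (Fin 2) ℝ).IsHadamard := by
      refine ⟨fun i j => ?_, ?_, ?_⟩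
      · rw [Unitary.mem_iff_eq_one_or_eq_neg_one]
        fin_cases i <;> fin_cases j <;> simp
      all_goals
        ext i j
        fin_cases i <;> fin_cases j <;> norm_num [Matrix.mul_apply]
    exact ⟨_, (hA.kronecker hB).reindex finProdFinEquiv finProdFinEquiv⟩

theorem sum_mul_eq_ite_of_isHadamard {n : Type*} [Fintype n] [DecidableEq n]
    {A : Matrix n n ℝ} (hA : A.IsHadamard) (a b : n) :
    ∑ i, A a i * A b i = if a = b then (Fintype.card n : ℝ) else 0 := by
  simpa [mul_apply, one_apply] using congrFun₂ hA.mul_conjTranspose a b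

section Signs

variable {ι κ Λ : Type*} [Fintype ι]

theorem sum_exp_sum_units_mul [DecidableEq ι] (a : ι → ℝ) :
    ∑ x : ι → ℤˣ, Real.exp (∑ i, (x i : ℝ) * a i) = ∏ i, (2 * Real.cosh (a i)) := by
  have h := prod_univ_sum (fun _ : ι => (univ : Finset ℤˣ)) fun i u => Real.exp ((u : ℝ) * a i)
  rw [Fintype.piFinset_univ] at h
  simp only [Real.exp_sum, ← h, UnitsInt.univ]
  refine prod_congr rfl fun i _ => ?_
  rw [sum_pair (by decide), Real.cosh_eq]
  simp [mul_div_cancel₀]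

theorem sum_exp_sum_units_mul_le [DecidableEq ι] (a : ι → ℝ) :
    ∑ x : ι → ℤˣ, Real.exp (∑ i, (x i : ℝ) * a i) ≤
      2 ^ Fintype.card ι * Real.exp (∑ i, a i ^ 2 / 2) := by
  rw [sum_exp_sum_units_mul, prod_mul_distrib, prod_const, card_univ, Real.exp_sum]
  gcongr with i
  exact Real.cosh_le_exp_half_sq (a i)

theorem sum_exp_abs_sum_units_mul_le [DecidableEq ι] (a : ι → ℝ) :
    ∑ x : ι → ℤˣ, Real.exp |∑ i, (x i : ℝ) * a i| ≤
      2 * (2 ^ Fintype.card ι * Real.exp (∑ i, a i ^ 2 / 2)) := by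
  calc ∑ x : ι → ℤˣ, Real.exp |∑ i, (x i : ℝ) * a i|
      ≤ ∑ x : ι → ℤˣ, (Real.exp (∑ i, (x i : ℝ) * a i) +
          Real.exp (∑ i, (x i : ℝ) * (-a) i)) := by
        refine sum_le_sum fun x _ => (Real.exp_abs_le _).trans_eq ?_
        simp only [Pi.neg_apply, mul_neg, sum_neg_distrib]
    _ ≤ 2 * (2 ^ Fintype.card ι * Real.exp (∑ i, a i ^ 2 / 2)) := by
        rw [sum_add_distrib, two_mul]
        refine add_le_add (sum_exp_sum_units_mul_le a) ((sum_exp_sum_units_mul_le _).trans_eq ?_)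
        simp only [Pi.neg_apply, neg_sq]

theorem exists_units_forall_abs_sum_mul_le [Fintype κ] {y : κ → ι → ℝ}
    (hy : ∀ k i, |y k i| ≤ 1) {ε : ℝ} (hε : 0 ≤ ε)
    (hcard : 2 * (Fintype.card κ : ℝ) < Real.exp (ε ^ 2 * Fintype.card ι / 2)) :
    ∃ x : ι → ℤˣ, ∀ k, |∑ i, (x i : ℝ) * y k i| ≤ ε * Fintype.card ι := by
  classical
  set N := Fintype.card ι
  set E := Real.exp (ε ^ 2 * N / 2) with hE
  -- If every sign vector failed, the average of the exponential moments would be too large.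
  by_contra! hbad
  have hlower (x : ι → ℤˣ) : E * E ≤ ∑ k, Real.exp |∑ i, (x i : ℝ) * (ε * y k i)| := by
    obtain ⟨k, hk⟩ := hbad x
    calc E * E = Real.exp (ε * (ε * N)) := by rw [hE, ← Real.exp_add]; ring_nf
      _ ≤ Real.exp |∑ i, (x i : ℝ) * (ε * y k i)| := by
          simp only [mul_left_comm _ ε, ← mul_sum, abs_mul, abs_of_nonneg hε]
          gcongr
      _ ≤ _ := single_le_sum (f := fun k => Real.exp |∑ i, (x i : ℝ) * (ε * y k i)|)
          (fun _ _ => by positivity) (mem_univ k)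
  have hupper (k : κ) :
      ∑ x : ι → ℤˣ, Real.exp |∑ i, (x i : ℝ) * (ε * y k i)| ≤ 2 * (2 ^ N * E) := by
    have hsum : ∑ i, (ε * y k i) ^ 2 / 2 ≤ ε ^ 2 * N / 2 := by
      calc ∑ i, (ε * y k i) ^ 2 / 2 ≤ ∑ _i : ι, ε ^ 2 / 2 := by
            gcongr ∑ i, ?_ / 2 with i
            rw [mul_pow]
            exact mul_le_of_le_one_right (sq_nonneg ε) ((sq_le_one_iff_abs_le_one _).mpr (hy k i))
        _ = ε ^ 2 * N / 2 := by rw [sum_const, card_univ, nsmul_eq_mul]; ring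
    refine (sum_exp_abs_sum_units_mul_le _).trans ?_
    gcongr
    exact Real.exp_le_exp.mpr hsum
  have hpos : 0 < 2 ^ N * E := by positivity
  refine absurd (mul_lt_mul_of_pos_left hcard hpos) (not_lt.mpr ?_)
  calc 2 ^ N * E * E = ∑ _x : ι → ℤˣ, E * E := by
        rw [sum_const, card_univ, Fintype.card_fun, Fintype.card_units_int, nsmul_eq_mul]
        push_cast
        ring
    _ ≤ ∑ x : ι → ℤˣ, ∑ k, Real.exp |∑ i, (x i : ℝ) * (ε * y k i)| :=
        sum_le_sum fun x _ => hlower x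
    _ ≤ ∑ _k : κ, 2 * (2 ^ N * E) := by
        rw [sum_comm]
        exact sum_le_sum fun k _ => hupper k
    _ = 2 ^ N * E * (2 * Fintype.card κ) := by rw [sum_const, card_univ, nsmul_eq_mul]; ring

-- The modulations are chosen greedily, one block at a time.
theorem exists_units_modulation [Fintype κ] (β : κ → Λ) {s : κ → ι → ℝ}
    (hs : ∀ a i, |s a i| ≤ 1) {ε : ℝ} (hε : 0 ≤ ε)
    (hcard : 2 * (Fintype.card κ : ℝ) ^ 2 < Real.exp (ε ^ 2 * Fintype.card ι / 2)) :
    ∃ g : Λ → ι → ℤˣ, ∀ a b, β a ≠ β b →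
      |∑ i, (g (β a) i * s a i) * (g (β b) i * s b i)| ≤ ε * Fintype.card ι := by
  classical
  suffices h : ∀ T : Finset Λ, ∃ g : Λ → ι → ℤˣ, ∀ a b, β a ∈ T → β b ∈ T → β a ≠ β b →
      |∑ i, (g (β a) i * s a i) * (g (β b) i * s b i)| ≤ ε * Fintype.card ι by
    obtain ⟨g, hg⟩ := h (univ.image β)
    exact ⟨g, fun a b => hg a b (mem_image_of_mem β (mem_univ a))
      (mem_image_of_mem β (mem_univ b))⟩
  intro T
  induction T using Finset.induction_on with
  | empty => exact ⟨1, by simp⟩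
  | insert l T hl ih =>
    obtain ⟨g, hg⟩ := ih
    have hbound (ab : κ × κ) (i : ι) : |g (β ab.1) i * s ab.1 i * s ab.2 i| ≤ 1 := by
      rcases Int.units_eq_one_or (g (β ab.1) i) with h | h <;>
        simpa [h, abs_mul] using mul_le_one₀ (hs _ i) (abs_nonneg _) (hs _ i)
    obtain ⟨x, hx⟩ := exists_units_forall_abs_sum_mul_le hbound hε
      (by simpa [sq] using hcard)
    have hnew (a b : κ) : |∑ i, (g (β a) i * s a i) * (x i * s b i)| ≤ ε * Fintype.card ι := by
      simpa only [mul_left_comm, mul_assoc] using hx (a, b)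
    refine ⟨Function.update g l x, fun a b ha hb hab => ?_⟩
    rcases mem_insert.mp ha with hal | haT <;> rcases mem_insert.mp hb with hbl | hbT
    · exact absurd (hal.trans hbl.symm) hab
    · rw [hal, Function.update_self, Function.update_of_ne (hal ▸ hab.symm)]
      simpa only [mul_comm] using hnew b a
    · rw [hbl, Function.update_self, Function.update_of_ne (hbl ▸ hab)]
      exact hnew a b
    · rw [Function.update_of_ne (ne_of_mem_of_not_mem haT hl),
        Function.update_of_ne (ne_of_mem_of_not_mem hbT hl)]
      exact hg a b haT hbT hab

end Signs

/-- A sequence of vectors of `ℝ ^ N` whose blocks of `N` consecutive members are orthonormal bases,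
and whose first `m` members are orthonormal up to `ε`. When the nodes of the binary tree are
numbered in breadth-first order and `N = 2 ^ D`, each block consists of the nodes `D` levels below
one node. -/
structure IsBlockFrame (ε : ℝ) (m N : ℕ) (ψ : ℕ → Fin N → ℝ) : Prop where
  orthonormal_block : ∀ a b, a / N = b / N → ψ a ⬝ᵥ ψ b = if a = b then 1 else 0
  almost_orthonormal : ∀ a < m, ∀ b < m, |(if a = b then 1 else 0) - ψ a ⬝ᵥ ψ b| ≤ ε

namespace IsBlockFrame

variable {ε : ℝ} {m N : ℕ} {ψ : ℕ → Fin N → ℝ}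

theorem dotProduct_self (h : IsBlockFrame ε m N ψ) (n : ℕ) : ψ n ⬝ᵥ ψ n = 1 := by
  rw [h.orthonormal_block n n rfl, if_pos rfl]

theorem parseval (h : IsBlockFrame ε m N ψ) (t : ℕ) (v : Fin N → ℝ) :
    ∑ b ∈ range N, (ψ (t * N + b) ⬝ᵥ v) ^ 2 = v ⬝ᵥ v := by
  let U : Matrix (Fin N) (Fin N) ℝ := Matrix.of fun b => ψ (t * N + b)
  have hdiv (b : Fin N) : (t * N + b) / N = t := by
    rw [mul_comm, Nat.mul_add_div b.pos, Nat.div_eq_of_lt b.2, add_zero]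
  have hU : U * Uᵀ = 1 := by
    ext b c
    change ψ (t * N + b) ⬝ᵥ ψ (t * N + c) = _
    rw [h.orthonormal_block _ _ ((hdiv b).trans (hdiv c).symm), Matrix.one_apply]
    simp only [Nat.add_left_cancel_iff, Fin.ext_iff]
  calc ∑ b ∈ range N, (ψ (t * N + b) ⬝ᵥ v) ^ 2 = (U *ᵥ v) ⬝ᵥ (U *ᵥ v) := by
        rw [sum_range]
        exact sum_congr rfl fun b _ => sq _
    _ = v ⬝ᵥ v := by
        rw [dotProduct_mulVec, ← mulVec_transpose, mulVec_mulVec, mul_eq_one_comm.mp hU,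
          one_mulVec]

end IsBlockFrame

theorem exists_isBlockFrame {N m : ℕ} [NeZero N] {A : Matrix (Fin N) (Fin N) ℝ}
    (hA : A.IsHadamard) {ε : ℝ} (hε : 0 ≤ ε)
    (hm : 2 * (m : ℝ) ^ 2 < Real.exp (ε ^ 2 * N / 2)) : ∃ ψ, IsBlockFrame ε m N ψ := by
  have hsign (a i) : A a i * A a i = 1 := by
    rcases Unitary.mem_iff_eq_one_or_eq_neg_one.mp (hA.apply_mem a i) with h | h <;> simp [h]
  have hN : (0 : ℝ) < N := by exact_mod_cast NeZero.pos N
  obtain ⟨g, hg⟩ := exists_units_modulation (κ := Fin m) (ι := Fin N) (fun a => a.val / N)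
    (s := fun a => A (Fin.ofNat N a)) (fun a i => abs_le_one_iff_mul_self_le_one.mpr (hsign _ i).le)
    hε (by simpa using hm)
  let ψ (n : ℕ) (i : Fin N) : ℝ := (√N)⁻¹ * (g (n / N) i * A (Fin.ofNat N n) i)
  have hdot (a b : ℕ) : ψ a ⬝ᵥ ψ b = (N : ℝ)⁻¹ * ∑ i,
      (g (a / N) i * A (Fin.ofNat N a) i) * (g (b / N) i * A (Fin.ofNat N b) i) := by
    have hsqrt : (√N)⁻¹ * (√N)⁻¹ = (N : ℝ)⁻¹ := by rw [← mul_inv, Real.mul_self_sqrt hN.le]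
    rw [mul_sum, ← hsqrt]
    exact sum_congr rfl fun i _ => by ring
  have hblock (a b : ℕ) (hab : a / N = b / N) : ψ a ⬝ᵥ ψ b = if a = b then 1 else 0 := by
    have hrow : Fin.ofNat N a = Fin.ofNat N b ↔ a = b := by
      rw [Fin.ext_iff, Fin.val_ofNat, Fin.val_ofNat]
      refine ⟨fun h => ?_, fun h => h ▸ rfl⟩
      rw [← Nat.div_add_mod a N, ← Nat.div_add_mod b N, hab, h]
    have hcancel (i : Fin N) : (g (b / N) i * A (Fin.ofNat N a) i) *
        (g (b / N) i * A (Fin.ofNat N b) i) = A (Fin.ofNat N a) i * A (Fin.ofNat N b) i := by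
      rcases Int.units_eq_one_or (g (b / N) i) with h | h <;> simp [h]
    simp only [hdot, hab, hcancel, sum_mul_eq_ite_of_isHadamard hA, hrow, Fintype.card_fin,
      mul_ite, mul_zero, inv_mul_cancel₀ hN.ne']
  refine ⟨ψ, hblock, fun a ha b hb => ?_⟩
  rcases eq_or_ne (a / N) (b / N) with hab | hab
  · rw [hblock a b hab, sub_self, abs_zero]
    exact hε
  · rw [if_neg (fun h : a = b => hab (h ▸ rfl)), zero_sub, abs_neg, hdot, abs_mul,
      abs_of_pos (inv_pos.mpr hN), inv_mul_le_iff₀ hN, mul_comm (N : ℝ)]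
    simpa using hg ⟨a, ha⟩ ⟨b, hb⟩ hab

theorem exists_isBlockFrame_two_pow {m : ℕ} (hm : m ≠ 0) {ε : ℝ} (hε : 0 < ε) (hε1 : ε < 1) :
    ∃ (D : ℕ) (ψ : ℕ → Fin (2 ^ D) → ℝ),
      (2 : ℝ) ^ D ≤ 4 * Real.log (2 * m ^ 2) / ε ^ 2 ∧ IsBlockFrame ε m (2 ^ D) ψ := by
  have hm1 : (1 : ℝ) ≤ (m : ℝ) ^ 2 := one_le_pow₀ (by exact_mod_cast Nat.one_le_iff_ne_zero.mpr hm)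
  have hlog : 1 / 2 < Real.log (2 * m ^ 2) := by
    calc (1 / 2 : ℝ) < Real.log 2 := by linarith [Real.log_two_gt_d9]
      _ ≤ Real.log (2 * m ^ 2) := Real.log_le_log two_pos (by linarith)
  have hx : 1 ≤ 2 * Real.log (2 * m ^ 2) / ε ^ 2 := by
    rw [le_div_iff₀ (by positivity)]
    nlinarith
  obtain ⟨n, hn, hn'⟩ := exists_nat_pow_near hx one_lt_two
  obtain ⟨A, hA⟩ := exists_isHadamard_two_pow (n + 1)
  have hexp : 2 * (m : ℝ) ^ 2 < Real.exp (ε ^ 2 * (2 ^ (n + 1) : ℕ) / 2) := by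
    rw [← Real.log_lt_iff_lt_exp (by positivity)]
    rw [div_lt_iff₀ (by positivity)] at hn'
    push_cast
    linarith
  obtain ⟨ψ, hψ⟩ := exists_isBlockFrame hA hε.le hexp
  refine ⟨n + 1, ψ, ?_, hψ⟩
  calc (2 : ℝ) ^ (n + 1) = 2 * 2 ^ n := pow_succ' _ _
    _ ≤ 2 * (2 * Real.log (2 * m ^ 2) / ε ^ 2) := by gcongr
    _ = 4 * Real.log (2 * m ^ 2) / ε ^ 2 := by ring

theorem exists_isBlockFrame_tree {ε : ℝ} (hε : 0 < ε) (hε1 : ε < 1) (H : ℕ) :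
    ∃ (D : ℕ) (ψ : ℕ → Fin (2 ^ D) → ℝ),
      (2 : ℝ) ^ D ≤ 12 * (H + 1) / ε ^ 2 ∧ IsBlockFrame ε (2 ^ (H + 1)) (2 ^ D) ψ := by
  obtain ⟨D, ψ, hD, hψ⟩ := exists_isBlockFrame_two_pow (pow_ne_zero (H + 1) two_ne_zero) hε hε1
  refine ⟨D, ψ, hD.trans ?_, hψ⟩
  have hlog : Real.log (2 * ((2 ^ (H + 1) : ℕ) : ℝ) ^ 2) = (2 * H + 3) * Real.log 2 := by
    have hpow : 2 * ((2 ^ (H + 1) : ℕ) : ℝ) ^ 2 = 2 ^ (2 * H + 3) := by push_cast; ring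
    rw [hpow, Real.log_pow]
    push_cast
    rfl
  rw [hlog]
  refine div_le_div_of_nonneg_right ?_ (sq_nonneg ε)
  nlinarith [Real.log_two_lt_d9]

theorem sum_Ico_mul (F : ℕ → ℝ) (N : ℕ) {a b : ℕ} (hab : a ≤ b) :
    ∑ n ∈ Ico (a * N) (b * N), F n = ∑ t ∈ Ico a b, ∑ j ∈ range N, F (t * N + j) := by
  induction b, hab using Nat.le_induction with
  | base => simp
  | succ b hab ih =>
    rw [sum_Ico_succ_top hab, ← ih, ← sum_Ico_consecutive F (Nat.mul_le_mul_right N hab)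
      (Nat.mul_le_mul_right N b.le_succ), sum_Ico_eq_sum_range F (b * N), Nat.succ_mul,
      Nat.add_sub_cancel_left]

/-- A unit mass at the root of the binary tree that flows down the tree, in breadth-first
numbering: at each node before depth `H` it splits into two parts, each at least a fraction `p` of
the mass of the node. -/
structure IsTreeSplitting (p : ℝ) (H : ℕ) (P : ℕ → ℝ) : Prop where
  root : P 1 = 1
  split : ∀ n, 1 ≤ n → n < 2 ^ H → P (2 * n) + P (2 * n + 1) = P n
  le_child : ∀ n, 2 ≤ n → n < 2 ^ (H + 1) → p * P (n / 2) ≤ P n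

namespace IsTreeSplitting

variable {p : ℝ} {H : ℕ} {P : ℕ → ℝ}

theorem child_le (h : IsTreeSplitting p H P) {n : ℕ} (hn : 2 ≤ n) (hnH : n < 2 ^ (H + 1)) :
    P n ≤ (1 - p) * P (n / 2) := by
  have hsplit := h.split (n / 2) (by omega) (by rw [pow_succ] at hnH; omega)
  rcases Nat.even_or_odd' n with ⟨m, rfl | rfl⟩
  · have hsibling := h.le_child (2 * m + 1) (by omega) (by rw [pow_succ] at hnH ⊢; omega)
    rw [show (2 * m + 1) / 2 = m by omega] at hsibling
    rw [show 2 * m / 2 = m by omega] at hsplit ⊢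
    linarith
  · have hsibling := h.le_child (2 * m) (by omega) (by omega)
    rw [show 2 * m / 2 = m by omega] at hsibling
    rw [show (2 * m + 1) / 2 = m by omega] at hsplit ⊢
    linarith

theorem le_pow (h : IsTreeSplitting p H P) (hp : p ≤ 1) {j n : ℕ} (hj : j ≤ H)
    (hjn : 2 ^ j ≤ n) (hnj : n < 2 ^ (j + 1)) : P n ≤ (1 - p) ^ j := by
  induction j generalizing n with
  | zero =>
    obtain rfl : n = 1 := by omega
    rw [h.root, pow_zero]
  | succ j ih =>
    have hnH : n < 2 ^ (H + 1) := hnj.trans_le (Nat.pow_le_pow_right two_pos (by omega))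
    have hj1 := Nat.one_le_two_pow (n := j)
    rw [pow_succ] at hjn hnj
    calc P n ≤ (1 - p) * P (n / 2) := h.child_le (by omega) hnH
      _ ≤ (1 - p) * (1 - p) ^ j :=
        mul_le_mul_of_nonneg_left (ih (by omega) (by omega) (by omega)) (by linarith)
      _ = (1 - p) ^ (j + 1) := (pow_succ' _ _).symm

theorem pow_mul_le_descendant (h : IsTreeSplitting p H P) (hp : 0 ≤ p) {j t b : ℕ} (ht : 1 ≤ t)
    (hb : b < 2 ^ j) (hbH : t * 2 ^ j + b < 2 ^ (H + 1)) :
    p ^ j * P t ≤ P (t * 2 ^ j + b) := by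
  induction j generalizing b with
  | zero =>
    obtain rfl : b = 0 := by omega
    simp
  | succ j ih =>
    have ht1 : 1 ≤ t * 2 ^ j := Nat.mul_pos ht (Nat.two_pow_pos j)
    rw [pow_succ 2, ← mul_assoc] at hbH ⊢
    rw [pow_succ] at hb
    have hparent : (t * 2 ^ j * 2 + b) / 2 = t * 2 ^ j + b / 2 := by omega
    calc p ^ (j + 1) * P t = p * (p ^ j * P t) := by rw [pow_succ', mul_assoc]
      _ ≤ p * P (t * 2 ^ j + b / 2) :=
        mul_le_mul_of_nonneg_left (ih (by omega) (by omega)) hp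
      _ ≤ P (t * 2 ^ j * 2 + b) := hparent ▸ h.le_child _ (by omega) hbH

theorem sum_level (h : IsTreeSplitting p H P) {j : ℕ} (hj : j ≤ H) :
    ∑ n ∈ Ico (2 ^ j) (2 ^ (j + 1)), P n = 1 := by
  induction j with
  | zero => simp [h.root]
  | succ j ih =>
    rw [pow_succ 2 (j + 1), pow_succ 2 j,
      sum_Ico_mul P 2 (Nat.le_mul_of_pos_right _ two_pos), ← pow_succ, ← ih (by omega)]
    refine sum_congr rfl fun n hn => ?_
    rw [mem_Ico] at hn
    have hnH : n < 2 ^ H := hn.2.trans_le (Nat.pow_le_pow_right two_pos hj)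
    rw [sum_range_succ, sum_range_one, mul_comm n 2]
    exact h.split n ((Nat.one_le_two_pow).trans hn.1) hnH

theorem sum_mul {ι : Type*} {s : Finset ι} {c : ι → ℝ} {Q : ι → ℕ → ℝ}
    (h : ∀ i ∈ s, IsTreeSplitting p H (Q i)) (hc : ∀ i ∈ s, 0 ≤ c i) (hc1 : ∑ i ∈ s, c i = 1) :
    IsTreeSplitting p H fun n => ∑ i ∈ s, c i * Q i n where
  root := by
    rw [← hc1]
    exact sum_congr rfl fun i hi => by rw [(h i hi).root, mul_one]
  split n hn hnH := by
    rw [← sum_add_distrib]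
    exact sum_congr rfl fun i hi => by rw [← mul_add, (h i hi).split n hn hnH]
  le_child n hn hnH := by
    rw [mul_sum]
    refine sum_le_sum fun i hi => ?_
    rw [mul_left_comm]
    exact mul_le_mul_of_nonneg_left ((h i hi).le_child n hn hnH) (hc i hi)

/-- Each bottom subtree of depth `D` has an orthonormal basis on its leaves, and on these leaves
the mass is comparable to the mass of the root of the subtree. -/
theorem pow_mul_dotProduct_self_le {ε : ℝ} {m D : ℕ} {ψ : ℕ → Fin (2 ^ D) → ℝ}
    (h : IsTreeSplitting p H P) (hp : 0 ≤ p) (hψ : IsBlockFrame ε m (2 ^ D) ψ) (hD : D ≤ H)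
    (u : Fin (2 ^ D) → ℝ) :
    p ^ D * (u ⬝ᵥ u) ≤ ∑ n ∈ Ico (2 ^ H) (2 ^ (H + 1)), P n * (ψ n ⬝ᵥ u) ^ 2 := by
  obtain ⟨J, rfl⟩ := Nat.exists_eq_add_of_le' hD
  have hpow : 2 ^ (J + D + 1) = 2 ^ (J + 1) * 2 ^ D := by ring
  rw [hpow, pow_add 2 J, sum_Ico_mul _ _ (Nat.pow_le_pow_right two_pos J.le_succ)]
  calc p ^ D * (u ⬝ᵥ u) = ∑ t ∈ Ico (2 ^ J) (2 ^ (J + 1)), p ^ D * P t * (u ⬝ᵥ u) := by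
        rw [← Finset.sum_mul, ← mul_sum, h.sum_level (Nat.le_add_right J D), mul_one]
    _ ≤ ∑ t ∈ Ico (2 ^ J) (2 ^ (J + 1)), ∑ b ∈ range (2 ^ D),
          P (t * 2 ^ D + b) * (ψ (t * 2 ^ D + b) ⬝ᵥ u) ^ 2 := by
      refine sum_le_sum fun t ht => ?_
      rw [mem_Ico] at ht
      rw [← hψ.parseval t u, mul_sum]
      refine sum_le_sum fun b hb => mul_le_mul_of_nonneg_right ?_ (sq_nonneg _)
      rw [mem_range] at hb
      refine h.pow_mul_le_descendant hp (Nat.one_le_two_pow.trans ht.1) hb ?_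
      calc t * 2 ^ D + b < (t + 1) * 2 ^ D := by rw [Nat.succ_mul]; omega
        _ ≤ 2 ^ (J + 1) * 2 ^ D := Nat.mul_le_mul_right _ ht.2
        _ = 2 ^ (J + D + 1) := hpow.symm

end IsTreeSplitting

/-- The number of the state-action pair `x` in breadth-first order. At a node of the tree this is
the number of the child of `x.1` chosen by `x.2`, where the leaves are given children too: the pairs
are the nodes below the root of a tree with one more level. -/
def pairIndex {H : ℕ} (x : TreeState H × Fin 2) : ℕ := 2 * x.1.val + x.2.val

section PairIndex

variable {H : ℕ}

theorem pairIndex_lt (x : TreeState H × Fin 2) : pairIndex x < 2 ^ (H + 1) := by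
  have := x.1.isLt
  have := x.2.isLt
  rw [pairIndex, pow_succ]
  omega

theorem pairIndex_injective : Function.Injective (pairIndex (H := H)) := fun x y h => by
  have := x.2.isLt
  have := y.2.isLt
  rw [pairIndex, pairIndex] at h
  exact Prod.ext (Fin.ext (by omega)) (Fin.ext (by omega))

theorem exists_pairIndex_eq {n : ℕ} (hn : n < 2 ^ (H + 1)) :
    ∃ x : TreeState H × Fin 2, x.1.val = n / 2 ∧ pairIndex x = n :=
  ⟨(⟨n / 2, by rw [pow_succ] at hn; omega⟩, ⟨n % 2, Nat.mod_lt _ two_pos⟩), rfl,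
    Nat.div_add_mod n 2⟩

theorem sum_pairIndex (F : ℕ → ℝ) :
    ∑ x : TreeState H × Fin 2, F (pairIndex x) = ∑ n ∈ range (2 ^ (H + 1)), F n := by
  rw [pow_succ, ← Fin.sum_univ_eq_sum_range, ← finProdFinEquiv.sum_comp]
  exact sum_congr rfl fun x _ => congrArg F (add_comm _ _)

theorem sum_pairIndex_ite (F : ℕ → ℝ) :
    ∑ x : TreeState H × Fin 2, (if 2 ^ H ≤ pairIndex x then F (pairIndex x) else 0) =
      ∑ n ∈ Ico (2 ^ H) (2 ^ (H + 1)), F n := by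
  rw [sum_pairIndex fun n => if 2 ^ H ≤ n then F n else 0, ← sum_filter, range_eq_Ico,
    Ico_filter_le, Nat.zero_max]

theorem log_pairIndex {x : TreeState H × Fin 2} (hx : x.1.val ≠ 0) :
    Nat.log 2 (pairIndex x) = Nat.log 2 x.1.val + 1 := by
  have hdiv : pairIndex x / 2 = x.1.val := by rw [pairIndex]; omega
  rw [Nat.log_of_one_lt_of_le one_lt_two (by rw [pairIndex]; omega), hdiv]

theorem IsTreeLeaf.val_ne_zero {s : TreeState H} (hs : IsTreeLeaf s) : s.val ≠ 0 := by
  have := Nat.two_pow_pos H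
  rw [IsTreeLeaf] at hs
  omega

theorem IsTreeLeaf.height_ne_zero {s : TreeState H} (hs : IsTreeLeaf s) : H ≠ 0 := by
  rintro rfl
  exact hs.val_ne_zero (Nat.lt_one_iff.mp s.isLt)

theorem isTreeLeaf_iff_le_pairIndex (hH : H ≠ 0) {x : TreeState H × Fin 2} :
    IsTreeLeaf x.1 ↔ 2 ^ H ≤ pairIndex x := by
  have : 2 ∣ 2 ^ H := dvd_pow_self 2 hH
  rw [IsTreeLeaf, pairIndex]
  omega

theorem log_pairIndex_eq_of_isTreeLeaf {x : TreeState H × Fin 2} (hx : IsTreeLeaf x.1) :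
    Nat.log 2 (pairIndex x) = H :=
  Nat.log_eq_of_pow_le_of_lt_pow ((isTreeLeaf_iff_le_pairIndex hx.height_ne_zero).mp hx)
    (pairIndex_lt x)

end PairIndex

/-- The probability that `π` follows the path from the root to node `n` of the binary tree. The
value `1` at `n = 0`, which is not a node, only simplifies the recursion. -/
noncomputable def Policy.pathProb {H : ℕ} (π : Policy (TreeState H) (Fin 2)) (n : ℕ) : ℝ :=
  if n ≤ 1 then 1
  else π.pathProb (n / 2) *
    if h : n / 2 < 2 ^ H then π.prob ⟨n / 2, h⟩ ⟨n % 2, Nat.mod_lt _ two_pos⟩ else 0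
termination_by n
decreasing_by omega

namespace Policy

variable {H : ℕ} (π : Policy (TreeState H) (Fin 2))

theorem pathProb_one : π.pathProb 1 = 1 := by
  rw [pathProb, if_pos le_rfl]

theorem pathProb_pairIndex {x : TreeState H × Fin 2} (hx : x.1.val ≠ 0) :
    π.pathProb (pairIndex x) = π.pathProb x.1.val * π.prob x.1 x.2 := by
  have hdiv : (2 * x.1.val + x.2.val) / 2 = x.1.val := by omega
  have hmod : (2 * x.1.val + x.2.val) % 2 = x.2.val := by omega
  rw [pairIndex, pathProb, if_neg (by omega)]
  simp only [hdiv, hmod, x.1.isLt, dif_pos]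

theorem pathProb_nonneg (n : ℕ) : 0 ≤ π.pathProb n := by
  induction n using Nat.strong_induction_on with
  | _ n ih =>
    rw [pathProb]
    split_ifs
    · exact zero_le_one
    · exact mul_nonneg (ih _ (by omega)) (π.prob_nonneg _ _)
    · rw [mul_zero]

theorem isTreeSplitting_pathProb {p : ℝ} (hπ : ∀ s a, p ≤ π.prob s a) :
    IsTreeSplitting p H π.pathProb where
  root := π.pathProb_one
  split n hn hnH := by
    have hchild (a : Fin 2) := π.pathProb_pairIndex (x := (⟨n, hnH⟩, a)) (Nat.ne_of_gt hn)
    have hleft : π.pathProb (2 * n) = _ := hchild 0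
    have hright : π.pathProb (2 * n + 1) = _ := hchild 1
    rw [hleft, hright, ← mul_add, ← Fin.sum_univ_two (fun a => π.prob ⟨n, hnH⟩ a), π.prob_sum,
      mul_one]
  le_child n hn hnH := by
    obtain ⟨x, hx, hxn⟩ := exists_pairIndex_eq hnH
    rw [← hx, ← hxn, π.pathProb_pairIndex (by omega), mul_comm p]
    exact mul_le_mul_of_nonneg_left (hπ _ _) (π.pathProb_nonneg _)

end Policy

theorem val_treeNext {H : ℕ} (s : TreeState H) (a : Fin 2) :
    (treeNext s a).val =
      if s.val ≠ 0 ∧ pairIndex (s, a) < 2 ^ H then pairIndex (s, a) else 0 := by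
  rw [treeNext]
  exact apply_dite Fin.val _ _ _

theorem eq_treeNext_iff {H : ℕ} {s s' : TreeState H} {a : Fin 2} (hs : s.val ≠ 0) :
    s = treeNext s' a ↔ s'.val ≠ 0 ∧ pairIndex (s', a) = s.val := by
  rw [Fin.ext_iff, val_treeNext]
  have := s.isLt
  split_ifs with h <;> omega

theorem treeNext_eq_terminal {H : ℕ} {s : TreeState H} (hs : s.val = 0 ∨ IsTreeLeaf s)
    (a : Fin 2) : treeNext s a = treeTerminal H := by
  rw [Fin.ext_iff, val_treeNext]
  refine if_neg ?_
  rw [pairIndex, not_and, not_lt]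
  intro h0
  exact (hs.resolve_left h0).trans (Nat.le_add_right _ _)

section TreeMDP

open FiniteMDP

variable {H : ℕ} {γ : ℝ} (hγ0 : 0 < γ) (hγ1 : γ < 1) (sStar : TreeState H) (aStar : Fin 2)

theorem stateLaw_treeMDP (π : Policy (TreeState H) (Fin 2)) (t : ℕ) {s : TreeState H}
    (hs : s.val ≠ 0) :
    (treeMDP H γ hγ0 hγ1 sStar aStar).stateLaw π t s =
      if t = Nat.log 2 s.val then π.pathProb s.val else 0 := by
  induction t generalizing s with
  | zero =>
    have hroot : 1 % 2 ^ H = 1 := Nat.mod_eq_of_lt (by omega)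
    change (if s = treeRoot H then 1 else 0) = _
    simp only [treeRoot, Fin.ext_iff, hroot, eq_comm (a := 0), Nat.log_eq_zero_iff]
    by_cases h : s.val = 1
    · simp [h, π.pathProb_one]
    · rw [if_neg h, if_neg (by omega)]
  | succ t ih =>
    change ∑ s', ∑ a, _ * (if s = treeNext s' a then 1 else 0) = _
    obtain ⟨x, hx, hxs⟩ := exists_pairIndex_eq (H := H) (s.isLt.trans (by rw [pow_succ]; omega))
    simp only [eq_treeNext_iff hs, ← hxs, pairIndex_injective.eq_iff]
    rw [← Fintype.sum_prod_type', sum_eq_single x]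
    · by_cases hx0 : x.1.val = 0
      · have hs1 : pairIndex x ≤ 1 := by omega
        rw [Nat.log_of_lt (Nat.lt_succ_of_le hs1)]
        simp [hx0]
      · rw [ih hx0, log_pairIndex hx0, π.pathProb_pairIndex hx0]
        simp [hx0]
    · intro y _ hy
      simp [hy]
    · simp

theorem occupancy_treeMDP (π : Policy (TreeState H) (Fin 2)) {x : TreeState H × Fin 2}
    (hx : x.1.val ≠ 0) :
    (treeMDP H γ hγ0 hγ1 sStar aStar).occupancy π x =
      (1 - γ) * γ ^ Nat.log 2 x.1.val * π.pathProb (pairIndex x) := by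
  simp only [occupancy, π.pathProb_pairIndex hx, stateLaw_treeMDP hγ0 hγ1 sStar aStar π _ hx]
  rw [tsum_eq_single (Nat.log 2 x.1.val) (fun t ht => by rw [if_neg ht, mul_zero]), if_pos rfl]
  change (1 - γ) * (γ ^ _ * _) * _ = _
  ring

theorem exists_isTreeSplitting_data {π : ℕ → Policy (TreeState H) (Fin 2)} {p : ℝ}
    (hπ : ∀ k s a, p ≤ (π k).prob s a) {μ : ℕ → TreeState H × Fin 2 → ℝ}
    (hμ : μ = (treeMDP H γ hγ0 hγ1 sStar aStar).onPolicyData π ∨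
      μ = (treeMDP H γ hγ0 hγ1 sStar aStar).replayData π) (k : ℕ) :
    ∃ P, IsTreeSplitting p H P ∧ ∀ x : TreeState H × Fin 2, x.1.val ≠ 0 →
      μ k x = (1 - γ) * γ ^ Nat.log 2 x.1.val * P (pairIndex x) := by
  have hP (i : ℕ) := (π i).isTreeSplitting_pathProb (hπ i)
  rcases hμ with rfl | rfl
  · exact ⟨_, hP k, fun x hx => occupancy_treeMDP hγ0 hγ1 sStar aStar (π k) hx⟩
  · have hsum : ∑ _i ∈ range (k + 1), 1 / ((k : ℝ) + 1) = 1 := by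
      rw [sum_const, card_range, nsmul_eq_mul, Nat.cast_succ, mul_one_div_cancel (by positivity)]
    refine ⟨_, IsTreeSplitting.sum_mul (fun i _ => hP i) (fun _ _ => by positivity) hsum,
      fun x hx => ?_⟩
    simp only [replayData, occupancy_treeMDP hγ0 hγ1 sStar aStar _ hx, ← mul_sum]
    ring

theorem bellman_treeMDP (Q : TreeState H × Fin 2 → ℝ) (x : TreeState H × Fin 2) :
    (treeMDP H γ hγ0 hγ1 sStar aStar).bellman Q x =
      (if x = (sStar, aStar) then 1 else 0) + γ * ⨆ a, Q (treeNext x.1 x.2, a) := by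
  simp [bellman, treeMDP, Prod.ext_iff]

theorem bellman_treeMDP_of_next_terminal {Q : TreeState H × Fin 2 → ℝ}
    (hQ : ∀ a, Q (treeTerminal H, a) = 0) {x : TreeState H × Fin 2}
    (hx : x.1.val = 0 ∨ IsTreeLeaf x.1) :
    (treeMDP H γ hγ0 hγ1 sStar aStar).bellman Q x = if x = (sStar, aStar) then 1 else 0 := by
  simp only [bellman_treeMDP, treeNext_eq_terminal hx, hQ, ciSup_const, mul_zero, add_zero]

theorem iSup_fin_two (f : Fin 2 → ℝ) : ⨆ a, f a = max (f 0) (f 1) := by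
  refine le_antisymm (ciSup_le fun a => ?_) (max_le ?_ ?_)
  · fin_cases a
    · exact le_max_left _ _
    · exact le_max_right _ _
  · exact le_ciSup (Set.finite_range f).bddAbove 0
  · exact le_ciSup (Set.finite_range f).bddAbove 1

/-- The value, at node `n` of the binary tree, of a unit reward collected on reaching the node `m`
of depth `H`: the discounted reward if `n` is an ancestor of `m`, and `0` otherwise. -/
noncomputable def ancestorValue (γ : ℝ) (H m n : ℕ) : ℝ :=
  if n = m / 2 ^ (H - Nat.log 2 n) then γ ^ (H - Nat.log 2 n) else 0

theorem mul_max_ancestorValue {γ : ℝ} (hγ : 0 ≤ γ) {H m n : ℕ} (hn : n ≠ 0) (hnH : n < 2 ^ H) :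
    γ * max (ancestorValue γ H m (2 * n)) (ancestorValue γ H m (2 * n + 1)) =
      ancestorValue γ H m n := by
  have hlog : Nat.log 2 n < H := Nat.log_lt_of_lt_pow hn hnH
  obtain ⟨j, rfl⟩ := Nat.exists_eq_add_of_lt hlog
  have hdepth : Nat.log 2 n + j + 1 - Nat.log 2 n = j + 1 := by omega
  have hdepth' : Nat.log 2 n + j + 1 - (Nat.log 2 n + 1) = j := by omega
  have hleft : Nat.log 2 (2 * n) = Nat.log 2 n + 1 := by
    rw [mul_comm, Nat.log_mul_base one_lt_two hn]
  have hright : Nat.log 2 (2 * n + 1) = Nat.log 2 n + 1 := by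
    rw [Nat.log_of_one_lt_of_le one_lt_two (by omega)]
    congr 2
    omega
  simp only [ancestorValue, hleft, hright, hdepth, hdepth', pow_succ 2, ← Nat.div_div_eq_div_mul]
  have hpow : 0 ≤ γ ^ j := pow_nonneg hγ j
  by_cases hanc : n = m / 2 ^ j / 2
  · rw [if_pos hanc, pow_succ']
    rcases Nat.mod_two_eq_zero_or_one (m / 2 ^ j) with h | h
    · rw [if_pos (by omega), if_neg (by omega), max_eq_left hpow]
    · rw [if_neg (by omega), if_pos (by omega), max_eq_right hpow]
  · rw [if_neg hanc, if_neg (by omega), if_neg (by omega), max_self, mul_zero]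

theorem Qstar_treeMDP (hleaf : IsTreeLeaf sStar) (x : TreeState H × Fin 2) :
    (treeMDP H γ hγ0 hγ1 sStar aStar).Qstar x =
      if x.1.val = 0 then 0 else ancestorValue γ H (pairIndex (sStar, aStar)) (pairIndex x) := by
  set M := treeMDP H γ hγ0 hγ1 sStar aStar
  set q : TreeState H × Fin 2 → ℝ := fun x =>
    if x.1.val = 0 then 0 else ancestorValue γ H (pairIndex (sStar, aStar)) (pairIndex x)
  suffices hfix : M.bellman q = q from
    congrFun (M.bellman_contracting.fixedPoint_unique hfix).symm x
  have hterminal (a : Fin 2) : q (treeTerminal H, a) = 0 := if_pos rfl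
  funext x
  by_cases hx0 : x.1.val = 0
  · rw [bellman_treeMDP_of_next_terminal hγ0 hγ1 sStar aStar hterminal (Or.inl hx0), if_neg]
    · exact (if_pos hx0).symm
    · rintro rfl
      exact hleaf.val_ne_zero hx0
  have hqx : q x = ancestorValue γ H (pairIndex (sStar, aStar)) (pairIndex x) := if_neg hx0
  by_cases hx : IsTreeLeaf x.1
  · rw [bellman_treeMDP_of_next_terminal hγ0 hγ1 sStar aStar hterminal (Or.inr hx), hqx,
      ancestorValue, log_pairIndex_eq_of_isTreeLeaf hx, Nat.sub_self, pow_zero,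
      Nat.div_one, pow_zero]
    simp only [pairIndex_injective.eq_iff]
  · have hxH : pairIndex x < 2 ^ H := not_le.mp fun h =>
      hx ((isTreeLeaf_iff_le_pairIndex hleaf.height_ne_zero).mpr h)
    have hindex : pairIndex x ≠ 0 := by rw [pairIndex]; omega
    have hnext : (treeNext x.1 x.2).val = pairIndex x := by
      rw [val_treeNext, if_pos ⟨hx0, hxH⟩]
    rw [bellman_treeMDP, if_neg (by rintro rfl; exact hx hleaf), zero_add, iSup_fin_two, hqx,
      ← mul_max_ancestorValue hγ0.le hindex hxH]
    have hchild (a : Fin 2) : q (treeNext x.1 x.2, a) = ancestorValue γ H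
        (pairIndex (sStar, aStar)) (2 * pairIndex x + a.val) := by
      rw [← hnext] at hindex ⊢
      exact if_neg hindex
    rw [hchild 0, hchild 1]
    rfl

theorem Qstar_treeMDP_rewarded (hleaf : IsTreeLeaf sStar) :
    (treeMDP H γ hγ0 hγ1 sStar aStar).Qstar (sStar, aStar) = 1 := by
  have hlog := log_pairIndex_eq_of_isTreeLeaf (x := (sStar, aStar)) hleaf
  rw [Qstar_treeMDP hγ0 hγ1 sStar aStar hleaf, if_neg hleaf.val_ne_zero, ancestorValue, hlog,
    Nat.sub_self, pow_zero, Nat.div_one, if_pos rfl, pow_zero]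

end TreeMDP

namespace FiniteMDP

theorem IsProjection.normal_eq {S A : Type} [Fintype S] [Fintype A] {d : ℕ}
    {Φ : Matrix (S × A) (Fin d) ℝ} {μ Y : S × A → ℝ} {w : Fin d → ℝ}
    (h : IsProjection Φ μ Y w) (v : Fin d → ℝ) :
    ∑ x, μ x * ((linearQ Φ w x - Y x) * linearQ Φ v x) = 0 := by
  set a := ∑ x, μ x * ((linearQ Φ w x - Y x) * linearQ Φ v x) with ha
  set b := ∑ x, μ x * linearQ Φ v x ^ 2 with hb
  have hloss (t : ℝ) : sqLoss μ (linearQ Φ (w + t • v)) Y =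
      sqLoss μ (linearQ Φ w) Y + (b * (t * t) + 2 * a * t) := by
    simp only [sqLoss, ha, hb, linearQ, mulVec_add, mulVec_smul, Pi.add_apply, Pi.smul_apply,
      smul_eq_mul, mul_sum, sum_mul, ← sum_add_distrib]
    exact sum_congr rfl fun x _ => by ring
  have hquadratic (t : ℝ) : 0 ≤ b * (t * t) + 2 * a * t + 0 := by
    have := h (w + t • v)
    rw [hloss] at this
    linarith
  have hdiscrim := discrim_le_zero hquadratic
  rw [discrim] at hdiscrim
  nlinarith [sq_nonneg a]

end FiniteMDP

/-- The level of a node of the tree, counted from the root. -/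
def treeLevel {H : ℕ} {s : TreeState H} (hs : s.val ≠ 0) : Fin H :=
  ⟨Nat.log 2 s.val, Nat.log_lt_of_lt_pow hs s.isLt⟩

theorem isTreeLeaf_iff_treeLevel_eq {H : ℕ} {s s' : TreeState H} (hs : s.val ≠ 0)
    (hs' : IsTreeLeaf s') : IsTreeLeaf s ↔ treeLevel hs = treeLevel hs'.val_ne_zero := by
  have hlog (t : TreeState H) (ht : t.val ≠ 0) : IsTreeLeaf t ↔ Nat.log 2 t.val + 1 = H := by
    rw [← log_pairIndex (x := (t, 0)) ht]
    refine ⟨log_pairIndex_eq_of_isTreeLeaf (x := (t, 0)), fun h => ?_⟩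
    exact Nat.pow_le_of_le_log (mul_ne_zero two_ne_zero ht) h.ge
  have hlog' := (hlog s' hs'.val_ne_zero).mp hs'
  rw [hlog s hs, treeLevel, treeLevel, Fin.mk.injEq]
  omega

/-- A weight vector with `H * N` entries, read as one block of `N` weights for each of the `H`
levels of the tree. -/
def weightBlocks (H N : ℕ) : (Fin (H * N) → ℝ) ≃ (Fin H → Fin N → ℝ) :=
  (finProdFinEquiv.symm.arrowCongr (Equiv.refl ℝ)).trans (Equiv.curry _ _ _)

theorem dotProduct_eq_sum_weightBlocks {H N : ℕ} (v w : Fin (H * N) → ℝ) :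
    v ⬝ᵥ w = ∑ l, weightBlocks H N v l ⬝ᵥ weightBlocks H N w l := by
  rw [dotProduct, ← finProdFinEquiv.sum_comp, Fintype.sum_prod_type]
  rfl

/-- The features of the tree made from a sequence of vectors `ψ`: the block of the level of `s` in
the row `(s, a)` is the vector whose index is the number of the pair, and the other blocks vanish.
-/
def treeFeatures (H N : ℕ) (ψ : ℕ → Fin N → ℝ) :
    Matrix (TreeState H × Fin 2) (Fin (H * N)) ℝ := fun x =>
  if hx : x.1.val ≠ 0 then
    (weightBlocks H N).symm (Pi.single (treeLevel hx) (ψ (pairIndex x)))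
  else 0

section Features

open FiniteMDP

variable {H N : ℕ} {ψ : ℕ → Fin N → ℝ}

theorem weightBlocks_treeFeatures {x : TreeState H × Fin 2} (hx : x.1.val ≠ 0) :
    weightBlocks H N (treeFeatures H N ψ x) = Pi.single (treeLevel hx) (ψ (pairIndex x)) := by
  rw [treeFeatures, dif_pos hx, Equiv.apply_symm_apply]

theorem treeFeatures_terminal (a : Fin 2) : treeFeatures H N ψ (treeTerminal H, a) = 0 :=
  dif_neg (not_not.mpr rfl)

theorem linearQ_treeFeatures_terminal (w : Fin (H * N) → ℝ) (a : Fin 2) :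
    linearQ (treeFeatures H N ψ) w (treeTerminal H, a) = 0 := by
  rw [linearQ, mulVec, treeFeatures_terminal, zero_dotProduct]

theorem linearQ_treeFeatures (w : Fin (H * N) → ℝ) {x : TreeState H × Fin 2}
    (hx : x.1.val ≠ 0) :
    linearQ (treeFeatures H N ψ) w x = ψ (pairIndex x) ⬝ᵥ weightBlocks H N w (treeLevel hx) := by
  rw [linearQ, mulVec, dotProduct_eq_sum_weightBlocks, weightBlocks_treeFeatures hx,
    sum_eq_single (treeLevel hx), Pi.single_eq_same]
  · intro l _ hl
    rw [Pi.single_eq_of_ne hl, zero_dotProduct]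
  · simp

theorem linearQ_treeFeatures_single {s : TreeState H} (hs : IsTreeLeaf s) (u : Fin N → ℝ)
    (x : TreeState H × Fin 2) :
    linearQ (treeFeatures H N ψ)
        ((weightBlocks H N).symm (Pi.single (treeLevel hs.val_ne_zero) u)) x =
      if 2 ^ H ≤ pairIndex x then ψ (pairIndex x) ⬝ᵥ u else 0 := by
  have hiff := isTreeLeaf_iff_le_pairIndex (x := x) hs.height_ne_zero
  by_cases hx : x.1.val = 0
  · obtain ⟨t, a⟩ := x
    obtain rfl : t = treeTerminal H := Fin.ext hx
    rw [linearQ_treeFeatures_terminal, if_neg fun h => (hiff.mpr h).val_ne_zero hx]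
  · rw [linearQ_treeFeatures _ hx, Equiv.apply_symm_apply]
    by_cases hleaf : IsTreeLeaf x.1
    · rw [if_pos (hiff.mp hleaf), (isTreeLeaf_iff_treeLevel_eq hx hs).mp hleaf, Pi.single_eq_same]
    · rw [if_neg (mt hiff.mpr hleaf),
        Pi.single_eq_of_ne (mt (isTreeLeaf_iff_treeLevel_eq hx hs).mpr hleaf), dotProduct_zero]

theorem isEpsRankFeatures_treeFeatures {ε : ℝ} (hε : 0 ≤ ε)
    (hψ : IsBlockFrame ε (2 ^ (H + 1)) N ψ) : IsEpsRankFeatures ε (treeFeatures H N ψ) := by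
  refine ⟨fun a j => congrFun (treeFeatures_terminal a) j, fun x y hx hy => ?_⟩
  replace hx : x.1.val ≠ 0 := fun h => hx (Fin.ext h)
  replace hy : y.1.val ≠ 0 := fun h => hy (Fin.ext h)
  have hone : (1 : Matrix (TreeState H × Fin 2) (TreeState H × Fin 2) ℝ) x y =
      if pairIndex x = pairIndex y then 1 else 0 := by
    simp only [one_apply, pairIndex_injective.eq_iff]
  rw [Matrix.sub_apply, hone]
  change |_ - linearQ (treeFeatures H N ψ) (treeFeatures H N ψ y) x| ≤ ε
  rw [linearQ_treeFeatures _ hx, weightBlocks_treeFeatures hy]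
  by_cases hlevel : treeLevel hx = treeLevel hy
  · rw [hlevel, Pi.single_eq_same]
    exact hψ.almost_orthonormal _ (pairIndex_lt x) _ (pairIndex_lt y)
  · have hne : pairIndex x ≠ pairIndex y := by
      rintro h
      cases pairIndex_injective h
      exact hlevel rfl
    rwa [Pi.single_eq_of_ne hlevel, dotProduct_zero, if_neg hne, sub_zero, abs_zero]

theorem exists_linearQ_near_Qstar {ε γ : ℝ} (hε : 0 ≤ ε)
    (hψ : IsBlockFrame ε (2 ^ (H + 1)) N ψ) (hγ0 : 0 < γ) (hγ1 : γ < 1) (sStar : TreeState H)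
    (aStar : Fin 2) (hleaf : IsTreeLeaf sStar) :
    ∃ w, ‖(treeMDP H γ hγ0 hγ1 sStar aStar).Qstar - linearQ (treeFeatures H N ψ) w‖ ≤ ε := by
  set m := pairIndex (sStar, aStar)
  let u (l : Fin H) : Fin N → ℝ := γ ^ (H - (l.val + 1)) • ψ (m / 2 ^ (H - (l.val + 1)))
  refine ⟨(weightBlocks H N).symm u, (pi_norm_le_iff_of_nonneg hε).mpr fun x => ?_⟩
  rw [Pi.sub_apply, Qstar_treeMDP hγ0 hγ1 sStar aStar hleaf, Real.norm_eq_abs]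
  by_cases hx : x.1.val = 0
  · obtain ⟨s, a⟩ := x
    obtain rfl : s = treeTerminal H := Fin.ext hx
    rwa [if_pos hx, linearQ_treeFeatures_terminal, sub_zero, abs_zero]
  · set j := H - Nat.log 2 (pairIndex x)
    have hblock : weightBlocks H N ((weightBlocks H N).symm u) (treeLevel hx) =
        γ ^ j • ψ (m / 2 ^ j) := by
      rw [Equiv.apply_symm_apply, show j = H - ((treeLevel hx).val + 1) from
        congrArg (H - ·) (log_pairIndex hx)]
    have hclose := hψ.almost_orthonormal _ (pairIndex_lt x) (m / 2 ^ j)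
      ((Nat.div_le_self _ _).trans_lt (pairIndex_lt _))
    rw [if_neg hx, linearQ_treeFeatures _ hx, hblock, dotProduct_smul, smul_eq_mul]
    calc |ancestorValue γ H m (pairIndex x) - γ ^ j * (ψ (pairIndex x) ⬝ᵥ ψ (m / 2 ^ j))|
        = γ ^ j * |(if pairIndex x = m / 2 ^ j then 1 else 0) -
            ψ (pairIndex x) ⬝ᵥ ψ (m / 2 ^ j)| := by
          rw [← abs_of_nonneg (pow_nonneg hγ0.le j), ← abs_mul, mul_sub, mul_ite, mul_one,
            mul_zero, abs_of_nonneg (pow_nonneg hγ0.le j)]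
          rfl
      _ ≤ 1 * ε := mul_le_mul (pow_le_one₀ hγ0.le hγ1.le) hclose (abs_nonneg _) zero_le_one
      _ = ε := one_mul ε

end Features

section LowerBound

open FiniteMDP Filter Topology

variable {H : ℕ} {ε γ p : ℝ} (hγ0 : 0 < γ) (hγ1 : γ < 1) {sStar : TreeState H} (aStar : Fin 2)
  {μ : TreeState H × Fin 2 → ℝ} {P : ℕ → ℝ}

theorem sum_leaf_mul_sq_eq {N : ℕ} {ψ : ℕ → Fin N → ℝ} (hleaf : IsTreeLeaf sStar)
    (hμ : ∀ x, x.1.val ≠ 0 → μ x = (1 - γ) * γ ^ Nat.log 2 x.1.val * P (pairIndex x))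
    {w w' : Fin (H * N) → ℝ}
    (hw : IsProjection (treeFeatures H N ψ) μ
      ((treeMDP H γ hγ0 hγ1 sStar aStar).bellman (linearQ (treeFeatures H N ψ) w')) w)
    {u : Fin N → ℝ} (hu : weightBlocks H N w (treeLevel hleaf.val_ne_zero) = u) :
    ∑ n ∈ Ico (2 ^ H) (2 ^ (H + 1)), P n * (ψ n ⬝ᵥ u) ^ 2 =
      P (pairIndex (sStar, aStar)) * (ψ (pairIndex (sStar, aStar)) ⬝ᵥ u) := by
  set l := treeLevel hleaf.val_ne_zero with hl
  set m := pairIndex (sStar, aStar)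
  set Y := (treeMDP H γ hγ0 hγ1 sStar aStar).bellman (linearQ (treeFeatures H N ψ) w')
  let v := (weightBlocks H N).symm (Pi.single l u)
  let F (n : ℕ) : ℝ := P n * (ψ n ⬝ᵥ u) ^ 2 - if n = m then P m * (ψ m ⬝ᵥ u) else 0
  have hterm (x : TreeState H × Fin 2) :
      μ x * ((linearQ (treeFeatures H N ψ) w x - Y x) * linearQ (treeFeatures H N ψ) v x) =
        (1 - γ) * γ ^ l.val * if 2 ^ H ≤ pairIndex x then F (pairIndex x) else 0 := by
    rw [linearQ_treeFeatures_single hleaf u x]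
    split_ifs with hx
    · replace hx := (isTreeLeaf_iff_le_pairIndex hleaf.height_ne_zero).mpr hx
      have hlevel := (isTreeLeaf_iff_treeLevel_eq hx.val_ne_zero hleaf).mp hx
      have hY : Y x = if pairIndex x = m then 1 else 0 := by
        simp only [Y, bellman_treeMDP_of_next_terminal hγ0 hγ1 sStar aStar
          (linearQ_treeFeatures_terminal w') (Or.inr hx), m, pairIndex_injective.eq_iff]
      rw [linearQ_treeFeatures _ hx.val_ne_zero, hlevel, ← hl, hu, hY, hμ x hx.val_ne_zero,
        show Nat.log 2 x.1.val = l.val from congrArg Fin.val hlevel]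
      by_cases hm : pairIndex x = m
      · simp only [F, hm, if_true]
        ring
      · simp only [F, hm, if_false]
        ring
    · simp only [mul_zero]
  have hm : m ∈ Ico (2 ^ H) (2 ^ (H + 1)) := mem_Ico.mpr
    ⟨(isTreeLeaf_iff_le_pairIndex hleaf.height_ne_zero).mp hleaf, pairIndex_lt _⟩
  have hnormal := hw.normal_eq v
  rw [sum_congr rfl fun x _ => hterm x, ← mul_sum, sum_pairIndex_ite, sum_sub_distrib,
    sum_ite_eq', if_pos hm] at hnormal
  exact sub_eq_zero.mp ((mul_eq_zero.mp hnormal).resolve_left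
    (mul_pos (sub_pos.mpr hγ1) (pow_pos hγ0 _)).ne')

theorem pow_mul_linearQ_rewarded_le {D : ℕ} {ψ : ℕ → Fin (2 ^ D) → ℝ}
    (hψ : IsBlockFrame ε (2 ^ (H + 1)) (2 ^ D) ψ) (hD : D ≤ H) (hleaf : IsTreeLeaf sStar)
    (hp : 0 ≤ p) (hp1 : p ≤ 1) (hP : IsTreeSplitting p H P)
    (hμ : ∀ x, x.1.val ≠ 0 → μ x = (1 - γ) * γ ^ Nat.log 2 x.1.val * P (pairIndex x))
    {w w' : Fin (H * 2 ^ D) → ℝ}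
    (hw : IsProjection (treeFeatures H (2 ^ D) ψ) μ
      ((treeMDP H γ hγ0 hγ1 sStar aStar).bellman (linearQ (treeFeatures H (2 ^ D) ψ) w')) w) :
    p ^ D * linearQ (treeFeatures H (2 ^ D) ψ) w (sStar, aStar) ≤ (1 - p) ^ H := by
  set m := pairIndex (sStar, aStar)
  set u := weightBlocks H (2 ^ D) w (treeLevel hleaf.val_ne_zero) with hu
  have hcauchy : (ψ m ⬝ᵥ u) ^ 2 ≤ u ⬝ᵥ u := by
    have h := sum_mul_sq_le_sq_mul_sq univ (ψ m) u
    simp only [sq (ψ m _), sq (u _)] at h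
    exact h.trans_eq ((congrArg (· * (u ⬝ᵥ u)) (hψ.dotProduct_self m)).trans (one_mul _))
  have hPm : P m ≤ (1 - p) ^ H := hP.le_pow hp1 le_rfl
    ((isTreeLeaf_iff_le_pairIndex hleaf.height_ne_zero).mp hleaf) (pairIndex_lt _)
  rw [linearQ_treeFeatures w (x := (sStar, aStar)) hleaf.val_ne_zero, ← hu]
  rcases le_or_gt (ψ m ⬝ᵥ u) 0 with hf | hf
  · exact (mul_nonpos_of_nonneg_of_nonpos (pow_nonneg hp D) hf).trans
      (pow_nonneg (sub_nonneg.mpr hp1) H)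
  · refine le_trans (le_of_mul_le_mul_right ?_ hf) hPm
    calc p ^ D * (ψ m ⬝ᵥ u) * (ψ m ⬝ᵥ u) = p ^ D * (ψ m ⬝ᵥ u) ^ 2 := by ring
      _ ≤ p ^ D * (u ⬝ᵥ u) := mul_le_mul_of_nonneg_left hcauchy (pow_nonneg hp D)
      _ ≤ ∑ n ∈ Ico (2 ^ H) (2 ^ (H + 1)), P n * (ψ n ⬝ᵥ u) ^ 2 :=
        hP.pow_mul_dotProduct_self_le hp hψ hD u
      _ = P m * (ψ m ⬝ᵥ u) := sum_leaf_mul_sq_eq hγ0 hγ1 aStar hleaf hμ hw hu.symm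

theorem eventually_forall_le_of_two_pow_le_mul (B : ℝ) :
    ∀ᶠ H : ℕ in atTop, ∀ D : ℕ, 2 ^ D ≤ B * H → D ≤ H := by
  have hlim : Tendsto (fun H : ℕ => B * ((H : ℝ) * (1 / 2) ^ H)) atTop (𝓝 0) := by
    simpa using (tendsto_self_mul_const_pow_of_lt_one (r := (1 / 2 : ℝ)) (by norm_num)
      (by norm_num)).const_mul B
  filter_upwards [hlim.eventually_lt_const one_pos] with H hH D hD
  have hlt : (2 : ℝ) ^ D < 2 ^ H := by
    calc (2 : ℝ) ^ D ≤ B * H := hD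
      _ = B * (H * (1 / 2) ^ H) * 2 ^ H := by rw [one_div, inv_pow]; field_simp
      _ < 1 * 2 ^ H := mul_lt_mul_of_pos_right hH (by positivity)
      _ = 2 ^ H := one_mul _
  exact ((pow_lt_pow_iff_right₀ one_lt_two).mp hlt).le

theorem eventually_forall_pow_lt_of_two_pow_le_mul (B : ℝ) {p q δ : ℝ} (hp : 0 < p)
    (hq : 0 ≤ q) (hq1 : q < 1) (hδ : 0 < δ) :
    ∀ᶠ H : ℕ in atTop, ∀ D : ℕ, 2 ^ D ≤ B * H → q ^ H < p ^ D * δ := by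
  obtain ⟨m, hm⟩ := exists_pow_lt_of_lt_one hp (one_half_lt_one (α := ℝ))
  have hlim : Tendsto (fun H : ℕ => B ^ m * ((H : ℝ) ^ m * q ^ H)) atTop (𝓝 0) := by
    simpa using (tendsto_pow_const_mul_const_pow_of_lt_one m hq hq1).const_mul (B ^ m)
  filter_upwards [hlim.eventually_lt_const hδ] with H hH D hD
  have hone : 1 ≤ (2 ^ D) ^ m * p ^ D := by
    calc (1 : ℝ) = (2 ^ D) ^ m * ((1 / 2) ^ m) ^ D := by
          rw [← pow_mul, ← pow_mul, mul_comm m D, ← mul_pow]; norm_num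
      _ ≤ (2 ^ D) ^ m * p ^ D := by gcongr
  calc q ^ H ≤ (2 ^ D) ^ m * p ^ D * q ^ H := le_mul_of_one_le_left (pow_nonneg hq H) hone
    _ ≤ (B * H) ^ m * p ^ D * q ^ H := by gcongr
    _ = p ^ D * (B ^ m * (H ^ m * q ^ H)) := by rw [mul_pow]; ring
    _ < p ^ D * δ := mul_lt_mul_of_pos_left hH (pow_pos hp D)

theorem eventually_forall_lt_norm_linearQ_sub_Qstar (B : ℝ) {η : ℝ} (hp : 0 < p) (hp1 : p < 1)
    (hη : η < 1) :
    ∀ᶠ H : ℕ in atTop, ∀ (D : ℕ) (ψ : ℕ → Fin (2 ^ D) → ℝ), 2 ^ D ≤ B * H →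
      IsBlockFrame ε (2 ^ (H + 1)) (2 ^ D) ψ →
      ∀ (γ : ℝ) (hγ0 : 0 < γ) (hγ1 : γ < 1) (sStar : TreeState H) (aStar : Fin 2),
      IsTreeLeaf sStar →
      ∀ π : ℕ → Policy (TreeState H) (Fin 2), (∀ k s a, p ≤ (π k).prob s a) →
      ∀ μ : ℕ → TreeState H × Fin 2 → ℝ,
        (μ = (treeMDP H γ hγ0 hγ1 sStar aStar).onPolicyData π ∨
          μ = (treeMDP H γ hγ0 hγ1 sStar aStar).replayData π) →
      ∀ w : ℕ → Fin (H * 2 ^ D) → ℝ,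
        (treeMDP H γ hγ0 hγ1 sStar aStar).IsFittedQRun (treeFeatures H (2 ^ D) ψ) μ w →
        ∀ k, η < ‖linearQ (treeFeatures H (2 ^ D) ψ) (w (k + 1)) -
          (treeMDP H γ hγ0 hγ1 sStar aStar).Qstar‖ := by
  filter_upwards [eventually_forall_le_of_two_pow_le_mul B,
    eventually_forall_pow_lt_of_two_pow_le_mul B hp (sub_nonneg.mpr hp1.le) (sub_lt_self 1 hp)
      (sub_pos.mpr hη)]
    with H hle hlt D ψ hDB hψ γ hγ0 hγ1 sStar aStar hleaf π hπ μ hμ w hw k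
  obtain ⟨P, hP, hμP⟩ := exists_isTreeSplitting_data hγ0 hγ1 sStar aStar hπ hμ k
  have hsmall : linearQ (treeFeatures H (2 ^ D) ψ) (w (k + 1)) (sStar, aStar) < 1 - η :=
    lt_of_mul_lt_mul_left ((pow_mul_linearQ_rewarded_le hγ0 hγ1 aStar hψ (hle D hDB) hleaf hp.le
      hp1.le hP hμP (hw k)).trans_lt (hlt D hDB)) (pow_nonneg hp.le D)
  refine lt_of_lt_of_le ?_ (norm_le_pi_norm _ (sStar, aStar))
  rw [Pi.sub_apply, Qstar_treeMDP_rewarded hγ0 hγ1 sStar aStar hleaf, Real.norm_eq_abs]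
  exact lt_abs.mpr (Or.inr (by linarith))

end LowerBound

theorem exists_pos_forall_lt_mul_le_one (rate : ℕ → ℝ) (n : ℕ) :
    ∃ c > 0, ∀ k < n, c * rate k ≤ 1 := by
  obtain ⟨b, hb⟩ := ((range n).image rate).bddAbove
  refine ⟨(max b 1)⁻¹, inv_pos.mpr (lt_max_of_lt_right one_pos), fun k hk => ?_⟩
  have hkb : rate k ≤ max b 1 :=
    le_max_of_le_left (hb (mem_coe.mpr (mem_image_of_mem rate (mem_range.mpr hk))))
  exact inv_mul_le_one_of_le₀ hkb (zero_le_one.trans (le_max_right b 1))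

/-- The function `rate` is arbitrary because, beyond some height, no iterate after the
initialization is `η`-accurate; `c` only accounts for the finitely many smaller heights. -/
theorem theorem1_general :
    ∃ C : ℝ, 0 < C ∧ ∀ ε : ℝ, 0 < ε → ε < 1 →
    ∃ (d : ℕ → ℕ) (Φ : (H : ℕ) → Matrix (TreeState H × Fin 2) (Fin (d H)) ℝ),
      (∀ H : ℕ, 1 ≤ H → (d H : ℝ) ≤ C * (H : ℝ) ^ 2 / ε ^ 2 ∧ IsEpsRankFeatures ε (Φ H) ∧
        ∀ (γ : ℝ) (hγ0 : 0 < γ) (hγ1 : γ < 1) (sStar : TreeState H) (aStar : Fin 2),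
          IsTreeLeaf sStar → ∃ w : Fin (d H) → ℝ,
            ‖(treeMDP H γ hγ0 hγ1 sStar aStar).Qstar - FiniteMDP.linearQ (Φ H) w‖ ≤ ε) ∧
      ∀ p : ℝ, 0 < p → p < 1 → ∀ η : ℝ, η < 1 → ∀ rate : ℕ → ℝ, ∃ c : ℝ, 0 < c ∧
      ∀ (H : ℕ) (γ : ℝ) (hγ0 : 0 < γ) (hγ1 : γ < 1) (sStar : TreeState H) (aStar : Fin 2),
      IsTreeLeaf sStar →
      ∀ π : ℕ → Policy (TreeState H) (Fin 2), (∀ k s a, p ≤ (π k).prob s a) →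
      ∀ μ : ℕ → TreeState H × Fin 2 → ℝ,
        (μ = (treeMDP H γ hγ0 hγ1 sStar aStar).onPolicyData π ∨
          μ = (treeMDP H γ hγ0 hγ1 sStar aStar).replayData π) →
      ∀ w : ℕ → Fin (d H) → ℝ,
        (treeMDP H γ hγ0 hγ1 sStar aStar).IsFittedQRun (Φ H) μ w →
        η < ‖FiniteMDP.linearQ (Φ H) (w 0) - (treeMDP H γ hγ0 hγ1 sStar aStar).Qstar‖ →
        ∀ K : ℕ,
          ‖FiniteMDP.linearQ (Φ H) (w K) - (treeMDP H γ hγ0 hγ1 sStar aStar).Qstar‖ ≤ η →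
          c * rate H ≤ K := by
  refine ⟨24, by norm_num, fun ε hε hε1 => ?_⟩
  choose D ψ hD hψ using exists_isBlockFrame_tree hε hε1
  have hDB {H : ℕ} (hH : 1 ≤ H) : (2 : ℝ) ^ D H ≤ 24 / ε ^ 2 * H := by
    have hcast : (1 : ℝ) ≤ H := Nat.one_le_cast.mpr hH
    calc (2 : ℝ) ^ D H ≤ 12 * (H + 1) / ε ^ 2 := hD H
      _ ≤ 12 * (H + H) / ε ^ 2 := by gcongr
      _ = 24 / ε ^ 2 * H := by ring
  refine ⟨fun H => H * 2 ^ D H, fun H => treeFeatures H (2 ^ D H) (ψ H), fun H hH =>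
    ⟨?_, isEpsRankFeatures_treeFeatures hε.le (hψ H), fun _ hγ0 hγ1 =>
      exists_linearQ_near_Qstar hε.le (hψ H) hγ0 hγ1⟩, fun p hp hp1 η hη rate => ?_⟩
  · calc ((H * 2 ^ D H : ℕ) : ℝ) = H * 2 ^ D H := by push_cast; rfl
      _ ≤ H * (24 / ε ^ 2 * H) := by gcongr; exact hDB hH
      _ = 24 * H ^ 2 / ε ^ 2 := by ring
  obtain ⟨H₀, hH₀⟩ := Filter.eventually_atTop.mp
    (eventually_forall_lt_norm_linearQ_sub_Qstar (ε := ε) (24 / ε ^ 2) hp hp1 hη)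
  obtain ⟨c, hc, hcle⟩ := exists_pos_forall_lt_mul_le_one rate H₀
  refine ⟨c, hc, fun H γ hγ0 hγ1 sStar aStar hleaf π hπ μ hμ w hw hinit K hK => ?_⟩
  obtain ⟨k, rfl⟩ := Nat.exists_eq_succ_of_ne_zero fun h : K = 0 => (h ▸ hK).not_gt hinit
  rcases lt_or_ge H H₀ with hH | hH
  · exact (hcle H hH).trans (Nat.one_le_cast.mpr k.succ_pos)
  · have hHpos : 1 ≤ H := Nat.one_le_iff_ne_zero.mpr hleaf.height_ne_zero
    exact absurd hK (hH₀ H hH (D H) (ψ H) (hDB hHpos) (hψ H) γ hγ0 hγ1 sStar aStar hleaf π hπ μ hμ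
      w hw k).not_ge

theorem theorem1 :
    ∃ C : ℝ, 0 < C ∧
    ∀ (ε : ℝ), 0 < ε → ε < 1 → ∀ (γ : ℝ) (hγ0 : 0 < γ) (hγ1 : γ < 1),
    ∃ (d : ℕ → ℕ) (Φ : (H : ℕ) → Matrix (TreeState H × Fin 2) (Fin (d H)) ℝ),
      -- the features: low-dimensional, nearly orthonormal, and nearly representing `Q*`
      (∀ H : ℕ, 1 ≤ H →
        (d H : ℝ) ≤ C * (H : ℝ) ^ 2 / ε ^ 2 ∧
        IsEpsRankFeatures ε (Φ H) ∧
        ∀ (sStar : TreeState H) (aStar : Fin 2), IsTreeLeaf sStar →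
          ∃ w : Fin (d H) → ℝ,
            ‖(treeMDP H γ hγ0 hγ1 sStar aStar).Qstar - FiniteMDP.linearQ (Φ H) w‖ ≤ ε) ∧
      -- the lower bound, for exploring policies and every target accuracy `η < 1`
      ∀ (p : ℝ), 0 < p → p < 1 / 2 → ∀ (η : ℝ), 0 < η → η < 1 →
      ∃ c : ℝ, 0 < c ∧
      ∀ (H : ℕ), 1 ≤ H → ∀ (sStar : TreeState H) (aStar : Fin 2), IsTreeLeaf sStar →
      ∀ (π : ℕ → Policy (TreeState H) (Fin 2)), (∀ k s a, p ≤ (π k).prob s a) →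
      ∀ (μ : ℕ → TreeState H × Fin 2 → ℝ),
        (μ = (treeMDP H γ hγ0 hγ1 sStar aStar).onPolicyData π ∨
          μ = (treeMDP H γ hγ0 hγ1 sStar aStar).replayData π) →
      ∀ (w : ℕ → Fin (d H) → ℝ),
        (treeMDP H γ hγ0 hγ1 sStar aStar).IsFittedQRun (Φ H) μ w →
        η < ‖FiniteMDP.linearQ (Φ H) (w 0) - (treeMDP H γ hγ0 hγ1 sStar aStar).Qstar‖ →
        ∀ K : ℕ,
          ‖FiniteMDP.linearQ (Φ H) (w K) - (treeMDP H γ hγ0 hγ1 sStar aStar).Qstar‖ ≤ η →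
          c * (γ ^ H)⁻¹ ≤ (K : ℝ) := by
  obtain ⟨C, hC, h⟩ := theorem1_general
  refine ⟨C, hC, fun ε hε hε1 γ hγ0 hγ1 => ?_⟩
  obtain ⟨d, Φ, hΦ, hlower⟩ := h ε hε hε1
  exact ⟨d, Φ, fun H hH => (hΦ H hH).imp_right (And.imp_right fun h => h γ hγ0 hγ1),
    fun p hp hp1 η _ hη => (hlower p hp (hp1.trans one_half_lt_one) η hη fun H => (γ ^ H)⁻¹).imp
      fun _ => And.imp_right fun h H _ => h H γ hγ0 hγ1⟩
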